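/- Let $\mathcal P_m=\mathbb F_2[x_1,\dots,x_m]$ ($m\ge 1$, each $x_j$ of degree $1$) with the usual action of the mod-2 Steenrod algebra: $Sq^k(x_j^n)=\binom nk x_j^{n+k}$, extended by linearity and the Cartan formula. Let $\overline{\mathscr A}\mathcal P_m=\sum_{k\ge1}\operatorname{im}(Sq^k)$ be the space of hit polynomials. A parameter vector is a sequence $\omega=(\omega_1,\omega_2,\dots)$ of non-negative integers with finitely many nonzero terms (trailing zeros are omitted); its degree is $\deg\omega=\sum_{i\ge1}2^{i-1}\omega_i$, and parameter vectors are ordered left-lexicographically. The parameter vector $\mathsf{Param}(X)$ of a monomial $X=x_1^{u_1}\cdots x_m^{u_m}$ has as its $i$-th entry the number of $j$ such that the binary digit of $u_j$ at $2^{i-1}$ is $1$. Let $\mathcal P_m^{\le\omega}$ (respectively $\mathcal P_m^{<\omega}$) be the span of the monomials $X$ of degree $\deg\omega$ with $\mathsf{Param}(X)\le\omega$ (respectively $<\omega$). Put $$(Q^{\otimes m})^{\omega}=\mathcal P_m^{\le\omega}\big/\big(\mathcal P_m^{\le\omega}\cap(\overline{\mathscr A}\mathcal P_m+\mathcal P_m^{<\omega})\big),$$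 and let $(Q^{\otimes m})^{\omega^{0}}$ and $(Q^{\otimes m})^{\omega^{>0}}$ be the subspaces of classes represented by elements of $\mathcal P_m^{\le\omega}$ that are combinations of monomials in which some exponent is zero, respectively in which all exponents are positive. Then: 1. For $m>0$ and $\omega=(m,0)$, of degree $m$: $\dim(Q^{\otimes m})^{\omega}=\dim(Q^{\otimes m})^{\omega^{>0}}=1$ and $(Q^{\otimes m})^{\omega^{0}}=0$. 2. For $m>1$ and $\omega=(m-1,1)$, of degree $m+1$: $\dim(Q^{\otimes m})^{\omega}=m^2-1$, $\dim(Q^{\otimes m})^{\omega^{0}}=m(m-1)$, $\dim(Q^{\otimes m})^{\omega^{>0}}=m-1$. 3. For $m>3$ and $\omega=(m-2,2)$, of degree $m+2$: $\dim(Q^{\otimes m})^{\omega}=\big(\binom m2+m\big)\big(\binom{m-1}2-1\big)$, $\dim(Q^{\otimes m})^{\omega^{0}}=\big(\binom m2+m-1\big)\big(\binom{m-1}2-1\big)$, $\dim(Q^{\otimes m})^{\omega^{>0}}=\binom{m-1}2-1$. 4. For $m>3$ and $\omega=(m,1)$, of degree $m+2$: $\dim(Q^{\otimes m})^{\omega}=\dim(Q^{\otimes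 m})^{\omega^{>0}}=m$ and $(Q^{\otimes m})^{\omega^{0}}=0$. 5. For $m>3$ and $\omega=(m-1,2)$, of degree $m+3$: $\dim(Q^{\otimes m})^{\omega}=3\binom m{m-3}+m(m-2)$, $\dim(Q^{\otimes m})^{\omega^{0}}=3\binom m{m-3}$, $\dim(Q^{\otimes m})^{\omega^{>0}}=m(m-2)$. In each of these cases $(Q^{\otimes m})^{\omega}=(Q^{\otimes m})^{\omega^{0}}\oplus(Q^{\otimes m})^{\omega^{>0}}$. Moreover the localized Kameko conjecture holds for these parameter vectors: for every $m\ge1$ and every $\omega\in\{(m,0),(m-1,1),(m-2,2),(m,1),(m-1,2)\}$ (with $m\ge2$ for $\omega=(m-2,2)$), $$\dim(Q^{\otimes m})^{\omega}\le\prod_{j=1}^m(2^j-1).$$ -/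

import Mathlib

namespace Hit

/-- The polynomial algebra `P_m = F_2[x_1, ..., x_m]`. -/
abbrev P (m : ℕ) : Type := MvPolynomial (Fin m) (ZMod 2)

/-- The total Steenrod square `Sq = ∑ Sq^k t^k`: the algebra homomorphism
`P_m → P_m[t]` with `x_j ↦ x_j + x_j^2 t`. -/
noncomputable def totalSq (m : ℕ) : P m →ₐ[ZMod 2] Polynomial (P m) :=
  MvPolynomial.aeval fun j =>
    Polynomial.C (MvPolynomial.X j) + Polynomial.C (MvPolynomial.X j ^ 2) * Polynomial.X

/-- The Steenrod square `Sq^k` on `P_m`. By `Sq_X_pow` and `Sq_mul` below it is the linear map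
determined by `Sq^k (x_j^n) = (n choose k) x_j^(n+k)` and the Cartan formula. -/
noncomputable def Sq (m k : ℕ) : P m →ₗ[ZMod 2] P m :=
  ((Polynomial.lcoeff (P m) k).restrictScalars (ZMod 2)) ∘ₗ (totalSq m).toLinearMap

theorem Sq_apply (m k : ℕ) (f : P m) : Sq m k f = (totalSq m f).coeff k := rfl

theorem Sq_X_pow (m k n : ℕ) (j : Fin m) :
    Sq m k (MvPolynomial.X j ^ n) = (n.choose k : P m) * MvPolynomial.X j ^ (n + k) := by
  have h : totalSq m (MvPolynomial.X j) = Polynomial.C (MvPolynomial.X j) *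
      (1 + Polynomial.C (MvPolynomial.X j) * Polynomial.X) := by
    simp only [totalSq, MvPolynomial.aeval_X, map_pow]
    ring
  have h2 : (1 + Polynomial.C (MvPolynomial.X j : P m) * Polynomial.X) ^ n =
      ((1 + Polynomial.X) ^ n : Polynomial (P m)).comp
        (Polynomial.C (MvPolynomial.X j) * Polynomial.X) := by
    simp
  rw [Sq_apply, map_pow, h, mul_pow, ← Polynomial.C_pow, Polynomial.coeff_C_mul, h2,
    Polynomial.comp_C_mul_X_coeff, Polynomial.coeff_one_add_X_pow]
  ring

theorem Sq_mul (m k : ℕ) (f g : P m) :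
    Sq m k (f * g) = ∑ p ∈ Finset.HasAntidiagonal.antidiagonal k, Sq m p.1 f * Sq m p.2 g := by
  simp only [Sq_apply, map_mul, Polynomial.coeff_mul]

/-- The space of hit polynomials: all sums of elements of the images of the
Steenrod squares of positive degree. -/
noncomputable def hit (m : ℕ) : Submodule (ZMod 2) (P m) :=
  ⨆ k : ℕ, ⨆ _ : 1 ≤ k, LinearMap.range (Sq m k)

/-- Parameter vectors: finitely supported sequences of natural numbers. The entry in position `i`
here is the one usually numbered `i + 1`. -/
abbrev ParamVec : Type := ℕ →₀ ℕ

/-- The parameter vector `(a, b, 0, 0, ...)`. -/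
noncomputable def pv (a b : ℕ) : ParamVec := Finsupp.single 0 a + Finsupp.single 1 b

/-- The degree `∑ 2^i ω_i` of a parameter vector `ω = (ω_0, ω_1, ...)`. -/
noncomputable def ParamVec.deg (ω : ParamVec) : ℕ := ω.sum fun i a => 2 ^ i * a

/-- The parameter vector of the monomial with exponents `u`: its entry in position `i` is the
number of exponents whose binary expansion has digit `1` at `2^i`. -/
noncomputable def paramOf {m : ℕ} (u : Fin m →₀ ℕ) : ParamVec :=
  Finsupp.onFinset (Finset.range u.degree) (fun i => ∑ j, u j / 2 ^ i % 2) (by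
    intro i hi
    obtain ⟨j, -, hj⟩ := Finset.exists_ne_zero_of_sum_ne_zero hi
    rw [Finset.mem_range]
    have h1 : u j ≤ u.degree := Finsupp.le_degree j u
    by_contra! hle
    have h2 : u j < 2 ^ i := lt_of_le_of_lt (h1.trans hle) Nat.lt_two_pow_self
    exact hj (by rw [Nat.div_eq_of_lt h2, Nat.zero_mod]))

theorem paramOf_apply {m : ℕ} (u : Fin m →₀ ℕ) (i : ℕ) :
    paramOf u i = ∑ j, u j / 2 ^ i % 2 := rfl

/-- `P_m^{≤ ω}`: the span of the monomials of degree `deg ω` whose parameter vector is at most `ω`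
in the left lexicographical order. -/
noncomputable def Ple (m : ℕ) (ω : ParamVec) : Submodule (ZMod 2) (P m) :=
  Submodule.span (ZMod 2) {f | ∃ u : Fin m →₀ ℕ, f = MvPolynomial.monomial u 1 ∧
    u.degree = ω.deg ∧ toLex (paramOf u) ≤ toLex ω}

/-- `P_m^{< ω}`: the span of the monomials of degree `deg ω` whose parameter vector is smaller
than `ω` in the left lexicographical order. -/
noncomputable def Plt (m : ℕ) (ω : ParamVec) : Submodule (ZMod 2) (P m) :=
  Submodule.span (ZMod 2) {f | ∃ u : Fin m →₀ ℕ, f = MvPolynomial.monomial u 1 ∧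
    u.degree = ω.deg ∧ toLex (paramOf u) < toLex ω}

/-- The elements of `P_m^{≤ ω}` that are equivalent to zero:
those in (hit polynomials) `+ P_m^{< ω}`. -/
noncomputable def null (m : ℕ) (ω : ParamVec) : Submodule (ZMod 2) (Ple m ω) :=
  (hit m ⊔ Plt m ω).comap (Ple m ω).subtype

/-- The cohit space `(Q^{⊗m})^ω`: the quotient of `P_m^{≤ ω}` by the relation
`F ∼_ω G ↔ F - G ∈ (hit polynomials) + P_m^{< ω}`. -/
abbrev Q (m : ℕ) (ω : ParamVec) : Type := Ple m ω ⧸ null m ω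

/-- `P_m^0`: the span of the monomials in which some variable has exponent zero. -/
noncomputable def Pzero (m : ℕ) : Submodule (ZMod 2) (P m) :=
  Submodule.span (ZMod 2) {f | ∃ u : Fin m →₀ ℕ, f = MvPolynomial.monomial u 1 ∧ ∏ j, u j = 0}

/-- `P_m^{>0}`: the span of the monomials in which every variable has positive exponent. -/
noncomputable def Ppos (m : ℕ) : Submodule (ZMod 2) (P m) :=
  Submodule.span (ZMod 2) {f | ∃ u : Fin m →₀ ℕ, f = MvPolynomial.monomial u 1 ∧ 0 < ∏ j, u j}

/-- The subspace of `(Q^{⊗m})^ω` of the classes represented by elements of `P_m^0`. -/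
noncomputable def Qzero (m : ℕ) (ω : ParamVec) : Submodule (ZMod 2) (Q m ω) :=
  ((Pzero m).comap (Ple m ω).subtype).map (null m ω).mkQ

/-- The subspace of `(Q^{⊗m})^ω` of the classes represented by elements of `P_m^{>0}`. -/
noncomputable def Qpos (m : ℕ) (ω : ParamVec) : Submodule (ZMod 2) (Q m ω) :=
  ((Ppos m).comap (Ple m ω).subtype).map (null m ω).mkQ

/-- All the spaces above are finite-dimensional, so `Module.finrank` is their dimension. -/
instance finite_Ple (m : ℕ) (ω : ParamVec) : Module.Finite (ZMod 2) (Ple m ω) := by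
  refine Module.Finite.span_of_finite (ZMod 2) (Set.Finite.subset
    ((Finset.finite_toSet (Finset.finsuppAntidiag (Finset.univ : Finset (Fin m)) ω.deg)).image
      (fun u => (MvPolynomial.monomial u 1 : P m))) ?_)
  rintro f ⟨u, rfl, hu, -⟩
  refine ⟨u, ?_, rfl⟩
  rw [Finset.mem_coe, Finset.mem_finsuppAntidiag]
  refine ⟨?_, Finset.subset_univ _⟩
  rw [← hu, Finsupp.degree_eq_sum]

/-- `dim (Q^{⊗m})^ω`. -/
noncomputable def dimQ (m : ℕ) (ω : ParamVec) : ℕ := Module.finrank (ZMod 2) (Q m ω)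

/-- The dimension of the part `0` of `(Q^{⊗m})^ω`. -/
noncomputable def dimQzero (m : ℕ) (ω : ParamVec) : ℕ := Module.finrank (ZMod 2) (Qzero m ω)

/-- The dimension of the part `> 0` of `(Q^{⊗m})^ω`. -/
noncomputable def dimQpos (m : ℕ) (ω : ParamVec) : ℕ := Module.finrank (ZMod 2) (Qpos m ω)

/-- The inequality of the localized Kameko conjecture for `m` variables and the parameter
vector `ω`. -/
def LocalizedKameko (m : ℕ) (ω : ParamVec) : Prop :=
  dimQ m ω ≤ ∏ j ∈ Finset.Icc 1 m, (2 ^ j - 1)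

end Hit

/-!
In each case write `ω = (m - e, b)` with `e, b ≤ 2`. A monomial with parameter vector `ω` has all
its exponents in `{0, 1, 2, 3}`. Let `Z`, `H`, `T` be the sets of variables with exponent `0`, `3`
and `2`, so that `|Z| + |T| = e` and `|H| + |T| = b`.

Modulo `2`, the coefficient of `x^v` in `Sq^k (x^u)` is a product of binomial coefficients, and if
all exponents of `v` are at most `3` it is nonzero only if `v` arises from `u` by turning `k`
exponents `1` into `2` (`coeff_Sq_monomial_of_le_three`). Hence the hit relations never mix
different pairs `(Z, H)`. For a fixed pair, with `R` the set of the remaining variables and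
`t = e - |Z|`, the monomials correspond to the `t`-element subsets `T` of `R`, and the relations
are generated by the sums over all `T` containing a given set `T₀` with fewer than `t` elements
(`classMap_Sq`, `polyOf_mem_hit_sup_Plt`). In this degree a monomial that is neither of parameter
vector `ω` nor smaller has only exponents `1` and `3` (`le_three_or_one_or_three`), and such a
monomial does not occur in any square `Sq^k` with `k ≥ 1`, so that nothing is lost in
passing to the quotient by the smaller monomials.

Therefore `(Q^{⊗m})^ω` is the product, over the pairs `(Z, H)`, of the spaces `Cohit R t`, and the
subspaces `Qzero` and `Qpos` are the partial products over the pairs with `Z` non-empty and with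
`Z` empty (`exists_equiv_cohitProd`). With `r = |R|`, the dimension of `Cohit R t` is `1`, `r - 1`
and `(r - 1 choose 2) - 1` for `t = 0, 1, 2`; for `t = 2` it is found from
the rank of the map `pairMap`.
Counting the pairs `(Z, H)` gives the dimensions for every `m ≥ e`, and so also the localized Kameko
inequality: for `m ≥ 4` its right-hand side is at least `m ^ 4`, and the smaller `m` are evaluated.
-/

namespace Hit

open Finset

/-! ### Matrix coefficients of the Steenrod squares -/

theorem totalSq_X (m : ℕ) (j : Fin m) (n : ℕ) :
    totalSq m (MvPolynomial.X j) ^ n = ∑ i ∈ range (n + 1),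
      Polynomial.monomial i ((n.choose i : P m) * MvPolynomial.X j ^ (n + i)) := by
  rw [← map_pow]
  ext1 k
  rw [← Sq_apply, Sq_X_pow, Polynomial.finsetSum_coeff]
  simp only [Polynomial.coeff_monomial]
  rw [Finset.sum_ite_eq' (range (n + 1)) k]
  split_ifs with h
  · rfl
  · rw [Nat.choose_eq_zero_of_lt (by simpa [Nat.lt_succ_iff] using h)]
    simp

theorem totalSq_monomial (m : ℕ) (u : Fin m →₀ ℕ) :
    totalSq m (MvPolynomial.monomial u 1) =
      ∑ p ∈ Fintype.piFinset fun j => range (u j + 1),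
        Polynomial.monomial (∑ j, p j)
          (MvPolynomial.monomial (u + Finsupp.equivFunOnFinite.symm p)
            ((∏ j, (u j).choose (p j) : ℕ) : ZMod 2)) := by
  rw [MvPolynomial.monomial_eq, Finsupp.prod_fintype _ _ (by simp)]
  simp only [map_one, one_mul, map_prod, map_pow, totalSq_X]
  rw [Finset.prod_univ_sum]
  refine Finset.sum_congr rfl fun p _ => ?_
  have h : ∀ s : Finset (Fin m), ∏ x ∈ s, (Polynomial.monomial (p x))
      (((u x).choose (p x) : P m) * MvPolynomial.X x ^ (u x + p x)) =
      Polynomial.monomial (∑ x ∈ s, p x)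
        (∏ x ∈ s, ((u x).choose (p x) : P m) * MvPolynomial.X x ^ (u x + p x)) := by
    intro s
    classical
    induction s using Finset.induction_on with
    | empty => simp
    | insert a s ha ih =>
      rw [prod_insert ha, prod_insert ha, sum_insert ha, ih, Polynomial.monomial_mul_monomial]
  rw [h, MvPolynomial.monomial_eq, Finsupp.prod_fintype _ _ (by simp), prod_mul_distrib]
  simp

/-- The coefficient of `x^v` in `Sq^k (x^u)` is `∏ (u_j choose v_j - u_j)` when the degrees fit. -/
theorem coeff_Sq_monomial (m k : ℕ) (u v : Fin m →₀ ℕ) :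
    MvPolynomial.coeff v (Sq m k (MvPolynomial.monomial u 1)) =
      if u ≤ v ∧ v.degree = u.degree + k then
        ((∏ j, (u j).choose (v j - u j) : ℕ) : ZMod 2) else 0 := by
  classical
  rw [Sq_apply, totalSq_monomial, Polynomial.finsetSum_coeff, MvPolynomial.coeff_sum]
  simp only [Polynomial.coeff_monomial]
  have hdeg : ∀ p : Fin m → ℕ, v = u + Finsupp.equivFunOnFinite.symm p →
      v.degree = u.degree + ∑ j, p j := by
    rintro p rfl
    simp [Finsupp.degree_eq_sum, sum_add_distrib]
  rw [Finset.sum_eq_single (fun j => v j - u j)]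
  · split_ifs with h1 h2 h2
    · have : u + Finsupp.equivFunOnFinite.symm (fun j => v j - u j) = v := by
        ext j
        simpa using Nat.add_sub_cancel' (h2.1 j)
      rw [this, MvPolynomial.coeff_monomial, if_pos rfl]
    · rw [MvPolynomial.coeff_monomial, if_neg]
      intro h
      refine h2 ⟨?_, by rw [hdeg _ h.symm, h1]⟩
      rw [← h]
      exact le_self_add
    · have : v = u + Finsupp.equivFunOnFinite.symm (fun j => v j - u j) := by
        ext j
        simpa using (Nat.add_sub_cancel' (h2.1 j)).symm
      exact absurd (Nat.add_left_cancel ((hdeg _ this).symm.trans h2.2)) h1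
    · simp
  · intro p _ hp
    split_ifs
    · rw [MvPolynomial.coeff_monomial, if_neg]
      rintro rfl
      apply hp
      ext j
      simp
    · simp
  · intro h
    have : ∃ j, u j < v j - u j := by
      by_contra! hc
      exact h (by simpa [Fintype.mem_piFinset, Nat.lt_succ_iff] using hc)
    obtain ⟨j, hj⟩ := this
    rw [Finset.prod_eq_zero (mem_univ j) (Nat.choose_eq_zero_of_lt hj)]
    simp

theorem degree_eq_of_coeff_Sq_ne_zero {m k : ℕ} {u v : Fin m →₀ ℕ}
    (h : MvPolynomial.coeff v (Sq m k (MvPolynomial.monomial u 1)) ≠ 0) :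
    v.degree = u.degree + k := by
  rw [coeff_Sq_monomial] at h
  by_contra hc
  exact h (if_neg fun hh => hc hh.2)

/-- Among the monomials with exponents at most `3`, the only way in which a Steenrod square can
act is to turn some exponents `1` into `2`: the binomial coefficients `(0 choose n)` for `n > 0`,
`(1 choose 2)` and `(2 choose 1)` vanish modulo `2`. -/
theorem coeff_Sq_monomial_of_le_three (m k : ℕ) (u v : Fin m →₀ ℕ) (hv : ∀ j, v j ≤ 3) :
    MvPolynomial.coeff v (Sq m k (MvPolynomial.monomial u 1)) =
      if (∀ j, u j = v j ∨ (u j = 1 ∧ v j = 2)) ∧ v.degree = u.degree + k then 1 else 0 := by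
  rw [coeff_Sq_monomial]
  by_cases h : ∀ j, u j = v j ∨ (u j = 1 ∧ v j = 2)
  · have hle : u ≤ v := fun j => by have := h j; omega
    have h1 : ∏ j, (u j).choose (v j - u j) = 1 :=
      Finset.prod_eq_one fun j _ => by
        rcases h j with h | ⟨h1, h2⟩
        · simp [h]
        · simp [h1, h2]
    simp [h, hle, h1]
  · rw [if_neg (c := (∀ j, u j = v j ∨ (u j = 1 ∧ v j = 2)) ∧ _) fun hh => h hh.1]
    split_ifs with h2
    · push Not at h
      obtain ⟨j, hj, hj'⟩ := h
      have h3 : ((u j).choose (v j - u j) : ZMod 2) = 0 := by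
        have h4 := h2.1 j
        have h5 := hv j
        have : u j ≤ 3 := h4.trans h5
        generalize u j = a at *
        generalize v j = b at *
        interval_cases b <;> interval_cases a <;> simp_all; decide
      rw [Nat.cast_prod]
      exact Finset.prod_eq_zero (mem_univ j) h3
    · rfl

/-! ### Monomials with exponents at most three -/

/-- The variables outside `Z ∪ H`, for a pair `c = (Z, H)` of sets of variables. -/
def rest {m : ℕ} (c : Finset (Fin m) × Finset (Fin m)) : Finset (Fin m) := (c.1 ∪ c.2)ᶜ

theorem mem_rest {m : ℕ} {c : Finset (Fin m) × Finset (Fin m)} {j : Fin m} :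
    j ∈ rest c ↔ j ∉ c.1 ∧ j ∉ c.2 := by
  simp [rest]

/-- For `c = (Z, H)`, the exponent vector with value `0` on `Z`, `3` on `H`, `2` on `T` and `1`
elsewhere. -/
noncomputable def word {m : ℕ} (c : Finset (Fin m) × Finset (Fin m)) (T : Finset (Fin m)) :
    Fin m →₀ ℕ :=
  Finsupp.equivFunOnFinite.symm fun j =>
    if j ∈ c.1 then 0 else if j ∈ c.2 then 3 else if j ∈ T then 2 else 1

theorem word_apply {m : ℕ} (c : Finset (Fin m) × Finset (Fin m)) (T : Finset (Fin m)) (j : Fin m) :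
    word c T j = if j ∈ c.1 then 0 else if j ∈ c.2 then 3 else if j ∈ T then 2 else 1 := rfl

theorem word_le_three {m : ℕ} (c : Finset (Fin m) × Finset (Fin m)) (T : Finset (Fin m))
    (j : Fin m) : word c T j ≤ 3 := by
  rw [word_apply]
  split_ifs <;> omega

/-- The pairs `c = (Z, H)` that occur as (zero set, set of exponents `3`) of a monomial with
parameter vector `(m - e, b)`. The other variables then have exponents `1` and `2`, and exactly
`e - |Z|` of them have exponent `2`. -/
def classes (m e b : ℕ) : Finset (Finset (Fin m) × Finset (Fin m)) :=
  univ.filter fun c => Disjoint c.1 c.2 ∧ #c.1 ≤ e ∧ #c.2 + (e - #c.1) = b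

theorem mem_classes {m e b : ℕ} {c : Finset (Fin m) × Finset (Fin m)} :
    c ∈ classes m e b ↔ Disjoint c.1 c.2 ∧ #c.1 ≤ e ∧ #c.2 + (e - #c.1) = b := by
  simp [classes]

theorem filter_word_eq_zero {m : ℕ} (c : Finset (Fin m) × Finset (Fin m)) (T : Finset (Fin m)) :
    univ.filter (fun j => word c T j = 0) = c.1 := by
  ext j
  rw [mem_filter_univ, word_apply]
  split_ifs <;> simp_all

theorem filter_word_eq_three {m : ℕ} {c : Finset (Fin m) × Finset (Fin m)}
    (hc : Disjoint c.1 c.2) (T : Finset (Fin m)) :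
    univ.filter (fun j => word c T j = 3) = c.2 := by
  ext j
  rw [mem_filter_univ, word_apply]
  have := @disjoint_left _ c.1 c.2
  split_ifs <;> simp_all

theorem filter_word_eq_two {m : ℕ} {c : Finset (Fin m) × Finset (Fin m)} {T : Finset (Fin m)}
    (hT : T ⊆ rest c) : univ.filter (fun j => word c T j = 2) = T := by
  ext j
  rw [mem_filter_univ, word_apply]
  have := @hT j
  rw [mem_rest] at this
  split_ifs <;> simp_all

theorem word_inj {m : ℕ} {c c' : Finset (Fin m) × Finset (Fin m)} {T T' : Finset (Fin m)}
    (hc : Disjoint c.1 c.2) (hc' : Disjoint c'.1 c'.2) (hT : T ⊆ rest c) (hT' : T' ⊆ rest c')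
    (h : word c T = word c' T') : c = c' ∧ T = T' := by
  refine ⟨Prod.ext ?_ ?_, ?_⟩
  · rw [← filter_word_eq_zero c T, h, filter_word_eq_zero]
  · rw [← filter_word_eq_three hc T, h, filter_word_eq_three hc']
  · rw [← filter_word_eq_two hT, h, filter_word_eq_two hT']

theorem pv_zero (a b : ℕ) : pv a b 0 = a := by simp [pv]

theorem pv_one (a b : ℕ) : pv a b 1 = b := by simp [pv]

theorem pv_of_two_le (a b : ℕ) {i : ℕ} (hi : 2 ≤ i) : pv a b i = 0 := by
  rw [pv, Finsupp.add_apply, Finsupp.single_apply, Finsupp.single_apply, if_neg (by omega),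
    if_neg (by omega), add_zero]

theorem deg_pv (a b : ℕ) : (pv a b).deg = a + 2 * b := by
  rw [ParamVec.deg, pv, Finsupp.sum_add_index' (by simp) (by intros; ring)]
  simp

theorem degree_eq_paramOf {m : ℕ} (v : Fin m →₀ ℕ) :
    v.degree = paramOf v 0 + 2 * paramOf v 1 + 4 * ∑ j, v j / 4 := by
  rw [Finsupp.degree_eq_sum, paramOf_apply, paramOf_apply, mul_sum, mul_sum, ← sum_add_distrib,
    ← sum_add_distrib]
  refine sum_congr rfl fun j _ => ?_
  omega

theorem paramOf_of_le_three {m : ℕ} {v : Fin m →₀ ℕ} (hv : ∀ j, v j ≤ 3) {i : ℕ} (hi : 2 ≤ i) :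
    paramOf v i = 0 := by
  rw [paramOf_apply]
  refine sum_eq_zero fun j _ => ?_
  have h4 : 2 ^ 2 ≤ 2 ^ i := Nat.pow_le_pow_right (by norm_num) hi
  rw [Nat.div_eq_of_lt (by have := hv j; omega), Nat.zero_mod]

theorem paramOf_zero_add {m : ℕ} {v : Fin m →₀ ℕ} (hv : ∀ j, v j ≤ 3) :
    paramOf v 0 + #(univ.filter fun j => v j = 0) + #(univ.filter fun j => v j = 2) = m := by
  rw [paramOf_apply, card_filter, card_filter, ← sum_add_distrib, ← sum_add_distrib]
  rw [sum_congr rfl (g := fun _ => 1)]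
  · simp
  · intro j _
    have := hv j
    split_ifs <;> omega

theorem paramOf_one {m : ℕ} {v : Fin m →₀ ℕ} (hv : ∀ j, v j ≤ 3) :
    paramOf v 1 = #(univ.filter fun j => v j = 3) + #(univ.filter fun j => v j = 2) := by
  rw [paramOf_apply, card_filter, card_filter, ← sum_add_distrib]
  refine sum_congr rfl fun j _ => ?_
  have := hv j
  split_ifs <;> omega

theorem paramOf_word {m a e b : ℕ} (hm : a + e = m) {c : Finset (Fin m) × Finset (Fin m)}
    (hc : c ∈ classes m e b) {T : Finset (Fin m)} (hT : T ∈ powersetCard (e - #c.1) (rest c)) :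
    paramOf (word c T) = pv a b := by
  obtain ⟨hc1, hc2, hc3⟩ := mem_classes.1 hc
  obtain ⟨hT1, hT2⟩ := mem_powersetCard.1 hT
  have h0 := paramOf_zero_add (word_le_three c T)
  have h1 := paramOf_one (word_le_three c T)
  rw [filter_word_eq_zero, filter_word_eq_two hT1] at h0
  rw [filter_word_eq_three hc1, filter_word_eq_two hT1] at h1
  ext i
  match i with
  | 0 => rw [pv_zero]; omega
  | 1 => rw [pv_one]; omega
  | i + 2 =>
    rw [pv_of_two_le _ _ (by omega), paramOf_of_le_three (word_le_three c T) (by omega)]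

theorem degree_word {m a e b : ℕ} (hm : a + e = m) {c : Finset (Fin m) × Finset (Fin m)}
    (hc : c ∈ classes m e b) {T : Finset (Fin m)} (hT : T ∈ powersetCard (e - #c.1) (rest c)) :
    (word c T).degree = a + 2 * b := by
  rw [degree_eq_paramOf, paramOf_word hm hc hT, pv_zero, pv_one, sum_eq_zero]
  · ring
  · intro j _
    have := word_le_three c T j
    omega

theorem eq_word_of_paramOf_eq {m a e b : ℕ} (hm : a + e = m) {v : Fin m →₀ ℕ}
    (hv : ∀ j, v j ≤ 3) (h : paramOf v = pv a b) :
    ∃ c ∈ classes m e b, ∃ T ∈ powersetCard (e - #c.1) (rest c), v = word c T := by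
  have h0 := paramOf_zero_add hv
  have h1 := paramOf_one hv
  rw [h, pv_zero] at h0
  rw [h, pv_one] at h1
  refine ⟨(univ.filter fun j => v j = 0, univ.filter fun j => v j = 3),
    mem_classes.2 ⟨?_, ?_, ?_⟩, univ.filter fun j => v j = 2, mem_powersetCard.2 ⟨?_, ?_⟩, ?_⟩
  · rw [disjoint_left]
    simp +contextual
  · simp only
    omega
  · simp only
    omega
  · intro j
    simp +contextual [mem_rest]
  · simp only
    omega
  · ext j
    have := hv j
    simp only [word_apply, mem_filter_univ]
    split_ifs <;> omega

/-- In degree `m - e + 2b` with `e, b ≤ 2`, a monomial whose parameter vector is at least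
`(m - e, b)` either has this parameter vector and exponents at most `3`, or all its exponents
are `1` and `3`. The second case can occur only for `e = b = 2`, with parameter vector `(m, 1)`. -/
theorem le_three_or_one_or_three {m a e b : ℕ} (hm : a + e = m) (he : e ≤ 2) (hb : b ≤ 2)
    {v : Fin m →₀ ℕ} (hv : v.degree = a + 2 * b)
    (h : ¬ toLex (paramOf v) < toLex (pv a b)) :
    (paramOf v = pv a b ∧ ∀ j, v j ≤ 3) ∨ ∀ j, v j = 1 ∨ v j = 3 := by
  have hd := degree_eq_paramOf v
  rw [hv] at hd
  have h3 : ∑ j, v j / 4 = 0 → ∀ j, v j ≤ 3 := fun hs j => by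
    have := (sum_eq_zero_iff.1 hs) j (mem_univ j)
    omega
  rcases (not_lt.1 h).eq_or_lt with h | h
  · have h : pv a b = paramOf v := h
    refine Or.inl ⟨h.symm, h3 ?_⟩
    rw [← h, pv_zero, pv_one] at hd
    omega
  · obtain ⟨i, hi, hlt⟩ := Finsupp.lex_def.1 h
    change ∀ d < i, pv a b d = paramOf v d at hi
    change pv a b i < paramOf v i at hlt
    match i with
    | 0 =>
      rw [pv_zero] at hlt
      have hodd : ∀ j, v j / 2 ^ 0 % 2 ≤ 1 := fun j => by omega
      have hsum : paramOf v 0 + ∑ j, (1 - v j / 2 ^ 0 % 2) = m := by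
        rw [paramOf_apply, ← sum_add_distrib, sum_congr rfl (g := fun _ => 1)]
        · simp
        · intro j _
          have := hodd j
          omega
      have hs0 : ∑ j, (1 - v j / 2 ^ 0 % 2) = 0 := by omega
      have h4 : ∑ j, v j / 4 = 0 := by omega
      right
      intro j
      have h5 := h3 h4 j
      have h6 := (sum_eq_zero_iff.1 hs0) j (mem_univ j)
      omega
    | 1 =>
      have := hi 0 (by omega)
      rw [pv_zero] at this
      rw [pv_one] at hlt
      omega
    | i + 2 =>
      have h0 := hi 0 (by omega)
      have h1 := hi 1 (by omega)
      rw [pv_zero] at h0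
      rw [pv_one] at h1
      rw [paramOf_of_le_three (h3 (by omega)) (by omega)] at hlt
      omega

theorem word_step_iff {m : ℕ} {c : Finset (Fin m) × Finset (Fin m)}
    {T : Finset (Fin m)} (hT : T ⊆ rest c) (u : Fin m →₀ ℕ) :
    (∀ j, u j = word c T j ∨ (u j = 1 ∧ word c T j = 2)) ↔ ∃ T₀ ⊆ T, u = word c T₀ := by
  have hT' : ∀ j ∈ T, j ∉ c.1 ∧ j ∉ c.2 := fun j hj => mem_rest.1 (hT hj)
  constructor
  · intro h
    refine ⟨T.filter fun j => u j = 2, filter_subset _ _, ?_⟩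
    ext j
    have h1 := h j
    have h2 := hT' j
    simp only [word_apply, mem_filter] at h1 ⊢
    split_ifs at h1 ⊢ <;> simp_all
  · rintro ⟨T₀, h, rfl⟩ j
    have h1 := @h j
    have h2 := hT' j
    simp only [word_apply]
    split_ifs <;> simp_all

theorem degree_word_add {m : ℕ} {c : Finset (Fin m) × Finset (Fin m)}
    (hc : Disjoint c.1 c.2) {T : Finset (Fin m)} (hT : T ⊆ rest c) :
    (word c T).degree + #c.1 = m + 2 * #c.2 + #T := by
  have h : (word c T).degree + #(univ.filter fun j => word c T j = 0) =
      (∑ _j : Fin m, 1) + 2 * #(univ.filter fun j => word c T j = 3) +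
        #(univ.filter fun j => word c T j = 2) := by
    rw [Finsupp.degree_eq_sum, card_filter, card_filter, card_filter, mul_sum, ← sum_add_distrib,
      ← sum_add_distrib, ← sum_add_distrib]
    refine sum_congr rfl fun j _ => ?_
    have := word_le_three c T j
    split_ifs <;> omega
  rwa [filter_word_eq_zero, filter_word_eq_three hc, filter_word_eq_two hT, sum_const,
    card_univ, Fintype.card_fin, smul_eq_mul, mul_one] at h

/-! ### Subsets modulo the inclusion vectors of smaller subsets -/

section Cohit

variable {α : Type*} [DecidableEq α]

/-- The indicator function, on the `t`-element subsets of `s`, of the sets containing `T₀`. -/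
def upVec (s : Finset α) (t : ℕ) (T₀ : Finset α) : powersetCard t s → ZMod 2 :=
  fun T => if T₀ ⊆ T.1 then 1 else 0

/-- The span of the functions `upVec s t T₀`, where `T₀` has fewer than `t` elements. -/
def upSpan (s : Finset α) (t : ℕ) : Submodule (ZMod 2) (powersetCard t s → ZMod 2) :=
  Submodule.span (ZMod 2) {g | ∃ T₀ ⊆ s, #T₀ < t ∧ g = upVec s t T₀}

/-- The functions on the `t`-element subsets of `s`, modulo the indicator functions of the sets
containing a given set with fewer than `t` elements. -/
abbrev Cohit (s : Finset α) (t : ℕ) : Type _ := (powersetCard t s → ZMod 2) ⧸ upSpan s t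

theorem upVec_mem_upSpan {s : Finset α} {t : ℕ} {T₀ : Finset α} (h : T₀ ⊆ s) (ht : #T₀ < t) :
    upVec s t T₀ ∈ upSpan s t :=
  Submodule.subset_span ⟨T₀, h, ht, rfl⟩

theorem finrank_cohit_add (s : Finset α) (t : ℕ) :
    Module.finrank (ZMod 2) (Cohit s t) + Module.finrank (ZMod 2) (upSpan s t) = (#s).choose t := by
  rw [Submodule.finrank_quotient_add_finrank, Module.finrank_fintype_fun_eq_card,
    Fintype.card_coe, card_powersetCard]

theorem finrank_cohit_zero (s : Finset α) : Module.finrank (ZMod 2) (Cohit s 0) = 1 := by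
  have h := finrank_cohit_add s 0
  have h0 : upSpan s 0 = ⊥ := by
    rw [upSpan, Submodule.span_eq_bot]
    rintro g ⟨T₀, -, h, -⟩
    omega
  have hf : Module.finrank (ZMod 2) (upSpan s 0) = 0 := by rw [h0, finrank_bot]
  rwa [hf, Nat.choose_zero_right] at h

theorem finrank_cohit_one (s : Finset α) : Module.finrank (ZMod 2) (Cohit s 1) = #s - 1 := by
  have h := finrank_cohit_add s 1
  rw [Nat.choose_one_right] at h
  rcases s.eq_empty_or_nonempty with rfl | ⟨i, hi⟩
  · rw [card_empty] at *
    omega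
  · have h1 : upSpan s 1 = Submodule.span (ZMod 2) {upVec s 1 ∅} := by
      rw [upSpan]
      congr 1
      ext g
      constructor
      · rintro ⟨T₀, -, hT, rfl⟩
        rw [Nat.lt_one_iff, card_eq_zero] at hT
        rw [hT]
        rfl
      · rintro rfl
        exact ⟨∅, empty_subset _, by simp, rfl⟩
    have hne : upVec s 1 ∅ ≠ 0 := fun h0 => by
      have := congrFun h0 ⟨{i}, mem_powersetCard.2 ⟨by simpa using hi, by simp⟩⟩
      simp [upVec] at this
    have hf : Module.finrank (ZMod 2) (upSpan s 1) = 1 := by rw [h1, finrank_span_singleton hne]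
    omega

/-- The map sending `(c, d)` to the function `{i, j} ↦ c_i + c_j + d` on two-element subsets. -/
def pairMap (s : Finset α) :
    ((s → ZMod 2) × ZMod 2) →ₗ[ZMod 2] (powersetCard 2 s → ZMod 2) where
  toFun x := fun T => (∑ i : s, if i.1 ∈ T.1 then x.1 i else 0) + x.2
  map_add' x y := by
    ext T
    have : ∀ i : s, (if i.1 ∈ T.1 then x.1 i + y.1 i else 0) =
      (if i.1 ∈ T.1 then x.1 i else 0) + (if i.1 ∈ T.1 then y.1 i else 0) := fun i => by
        split_ifs <;> simp
    simp only [Prod.fst_add, Prod.snd_add, Pi.add_apply, this, sum_add_distrib]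
    ring
  map_smul' r x := by
    ext T
    simp [mul_add, mul_sum]

theorem pairMap_single (s : Finset α) (i : s) :
    pairMap s (Pi.single i 1, 0) = upVec s 2 {i.1} := by
  ext T
  simp only [pairMap, LinearMap.coe_mk, AddHom.coe_mk, upVec, singleton_subset_iff, add_zero]
  rw [sum_eq_single i]
  · simp
  · intro j _ hj
    simp [hj]
  · simp

theorem pairMap_one (s : Finset α) : pairMap s (0, 1) = upVec s 2 ∅ := by
  ext T
  simp [pairMap, upVec]

theorem range_pairMap (s : Finset α) : LinearMap.range (pairMap s) = upSpan s 2 := by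
  apply le_antisymm
  · rintro _ ⟨⟨c, d⟩, rfl⟩
    have h : ((c, d) : (s → ZMod 2) × ZMod 2) =
        ∑ i : s, c i • ((Pi.single i 1, 0) : (s → ZMod 2) × ZMod 2) + d • (0, 1) := by
      ext j
      · simp [Prod.fst_sum, Finset.sum_apply, Pi.single_apply]
      · simp [Prod.snd_sum]
    rw [h, map_add, map_sum]
    refine Submodule.add_mem _ (Submodule.sum_mem _ fun i _ => ?_) ?_
    · rw [map_smul, pairMap_single]
      exact Submodule.smul_mem _ _ (upVec_mem_upSpan (by simp) (by simp))
    · rw [map_smul, pairMap_one]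
      exact Submodule.smul_mem _ _ (upVec_mem_upSpan (by simp) (by simp))
  · rw [upSpan, Submodule.span_le]
    rintro g ⟨T₀, hs, hT, rfl⟩
    obtain h | h : #T₀ = 0 ∨ #T₀ = 1 := by omega
    · rw [card_eq_zero.1 h]
      exact ⟨_, pairMap_one s⟩
    · obtain ⟨i, rfl⟩ := card_eq_one.1 h
      exact ⟨_, pairMap_single s ⟨i, by simpa using hs⟩⟩

theorem pairMap_pair (s : Finset α) (c : s → ZMod 2) (d : ZMod 2) {i j : s} (hij : i ≠ j)
    (h : {i.1, j.1} ∈ powersetCard 2 s) :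
    pairMap s (c, d) ⟨{i.1, j.1}, h⟩ = c i + c j + d := by
  simp only [pairMap, LinearMap.coe_mk, AddHom.coe_mk]
  congr 1
  rw [← sum_pair hij, ← sum_filter]
  refine sum_congr ?_ fun _ _ => rfl
  ext k
  simp only [mem_filter_univ, mem_insert, mem_singleton, Subtype.coe_inj]

/-- For at least three points, `c_i + c_j = d` for all `i ≠ j` forces `c` to be constant and
`d = 0`: adding the equations of a triangle gives `d = 3d = 0`. -/
theorem finrank_ker_pairMap (s : Finset α) (hs : 3 ≤ #s) :
    Module.finrank (ZMod 2) (LinearMap.ker (pairMap s)) = 1 := by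
  have triangle : ∀ x y z d : ZMod 2, x + y + d = 0 → x + z + d = 0 → y + z + d = 0 → d = 0 := by
    decide
  have hpair : ∀ i j : s, i ≠ j → ({i.1, j.1} : Finset α) ∈ powersetCard 2 s := fun i j hij =>
    mem_powersetCard.2 ⟨by simp [insert_subset_iff],
      card_pair (Subtype.val_injective.ne hij)⟩
  have hone : pairMap s ((fun _ => 1), 0) = 0 := by
    ext ⟨T, hT⟩
    obtain ⟨i, j, hij, rfl⟩ := card_eq_two.1 (mem_powersetCard.1 hT).2
    have hsub := (mem_powersetCard.1 hT).1
    have h := pairMap_pair s (fun _ => 1) 0 (i := ⟨i, hsub (by simp)⟩) (j := ⟨j, hsub (by simp)⟩)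
      (by simpa using hij) hT
    rw [h]
    exact (show (1 : ZMod 2) + 1 + 0 = 0 by decide)
  obtain ⟨i, j, k, hi, hj, hk, hij, hik, hjk⟩ := (two_lt_card_iff).1 hs
  rw [finrank_eq_one_iff']
  refine ⟨⟨((fun _ => 1), 0), hone⟩, ?_, ?_⟩
  · intro h
    have := congrFun (congrArg Prod.fst (Subtype.ext_iff.1 h)) ⟨i, hi⟩
    simp at this
  · rintro ⟨⟨c, d⟩, hcd⟩
    have hcd' : ∀ i j : s, i ≠ j → c i + c j + d = 0 := fun i j h => by
      rw [← pairMap_pair s c d h (hpair i j h), LinearMap.mem_ker.1 hcd]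
      rfl
    have e1 := hcd' ⟨i, hi⟩ ⟨j, hj⟩ (by simpa using hij)
    have e2 := hcd' ⟨i, hi⟩ ⟨k, hk⟩ (by simpa using hik)
    have e3 := hcd' ⟨j, hj⟩ ⟨k, hk⟩ (by simpa using hjk)
    obtain rfl : d = 0 := triangle _ _ _ d e1 e2 e3
    refine ⟨c ⟨i, hi⟩, ?_⟩
    ext l
    · by_cases hl : l = ⟨i, hi⟩
      · simp [hl]
      · have := hcd' l _ hl
        rw [add_zero] at this
        simpa using (CharTwo.add_eq_zero.1 this).symm
    · simp

theorem finrank_cohit_two (s : Finset α) :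
    Module.finrank (ZMod 2) (Cohit s 2) = (#s - 1).choose 2 - 1 := by
  have h := finrank_cohit_add s 2
  by_cases hs : 3 ≤ #s
  · have h1 := LinearMap.finrank_range_add_finrank_ker (pairMap s)
    rw [finrank_ker_pairMap s hs, range_pairMap, Module.finrank_prod,
      Module.finrank_fintype_fun_eq_card, Fintype.card_coe, Module.finrank_self] at h1
    obtain ⟨r, hr⟩ : ∃ r, #s = r + 1 := ⟨#s - 1, by omega⟩
    rw [hr] at h h1 hs ⊢
    have h2 : (r + 1).choose 2 = r + r.choose 2 := by
      rw [Nat.choose_succ_succ' r 1, Nat.choose_one_right]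
    rw [Nat.add_sub_cancel]
    omega
  · have h0 : (#s - 1).choose 2 = 0 := Nat.choose_eq_zero_of_lt (by omega)
    rw [h0]
    by_cases h2 : #s = 2
    · have hT : s ∈ powersetCard 2 s := mem_powersetCard.2 ⟨subset_rfl, h2⟩
      have hne : upVec s 2 ∅ ≠ 0 := fun h0 => by
        have := congrFun h0 ⟨s, hT⟩
        simp [upVec] at this
      have : 0 < Module.finrank (ZMod 2) (upSpan s 2) := by
        rw [Module.finrank_pos_iff_exists_ne_zero]
        exact ⟨⟨_, upVec_mem_upSpan (empty_subset s) (by simp)⟩,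
          fun h => hne (congrArg Subtype.val h)⟩
      rw [h2, Nat.choose_self] at h
      omega
    · rw [Nat.choose_eq_zero_of_lt (by omega)] at h
      omega

end Cohit

/-! ### The cohit space as a product over the classes -/

/-- The coefficients of the monomials `word c T` in a polynomial, for `T` of size `t`. -/
noncomputable def coords {m : ℕ} (c : Finset (Fin m) × Finset (Fin m)) (t : ℕ) :
    P m →ₗ[ZMod 2] (powersetCard t (rest c) → ZMod 2) :=
  LinearMap.pi fun T => MvPolynomial.lcoeff _ (word c T.1)

theorem coords_apply {m : ℕ} (c : Finset (Fin m) × Finset (Fin m)) (t : ℕ) (f : P m)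
    (T : powersetCard t (rest c)) : coords c t f T = MvPolynomial.coeff (word c T.1) f := rfl

/-- The class of the coefficient function `coords c t f` in `Cohit`. -/
noncomputable def classMap {m : ℕ} (c : Finset (Fin m) × Finset (Fin m)) (t : ℕ) :
    P m →ₗ[ZMod 2] Cohit (rest c) t :=
  (upSpan (rest c) t).mkQ ∘ₗ coords c t

theorem classMap_apply {m : ℕ} (c : Finset (Fin m) × Finset (Fin m)) (t : ℕ) (f : P m) :
    classMap c t f = (upSpan (rest c) t).mkQ (coords c t f) := rfl

/-- The polynomial with given coefficients at the monomials `word c T`, for `T` of size `t`. -/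
noncomputable def polyOf {m : ℕ} (c : Finset (Fin m) × Finset (Fin m)) (t : ℕ) :
    (powersetCard t (rest c) → ZMod 2) →ₗ[ZMod 2] P m :=
  ∑ T, MvPolynomial.monomial (word c T.1) ∘ₗ LinearMap.proj T

theorem polyOf_apply {m : ℕ} (c : Finset (Fin m) × Finset (Fin m)) (t : ℕ)
    (g : powersetCard t (rest c) → ZMod 2) :
    polyOf c t g = ∑ T, MvPolynomial.monomial (word c T.1) (g T) := by
  simp [polyOf]

theorem coeff_polyOf_eq_zero {m : ℕ} {c : Finset (Fin m) × Finset (Fin m)} {t : ℕ}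
    (g : powersetCard t (rest c) → ZMod 2) {v : Fin m →₀ ℕ}
    (hv : ∀ T ∈ powersetCard t (rest c), v ≠ word c T) :
    MvPolynomial.coeff v (polyOf c t g) = 0 := by
  rw [polyOf_apply, MvPolynomial.coeff_sum]
  refine sum_eq_zero fun T _ => ?_
  rw [MvPolynomial.coeff_monomial, if_neg fun h => hv T.1 T.2 h.symm]

theorem coeff_polyOf_word {m : ℕ} {c : Finset (Fin m) × Finset (Fin m)} (hc : Disjoint c.1 c.2)
    {t : ℕ} (g : powersetCard t (rest c) → ZMod 2) (T : powersetCard t (rest c)) :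
    MvPolynomial.coeff (word c T.1) (polyOf c t g) = g T := by
  rw [polyOf_apply, MvPolynomial.coeff_sum, sum_eq_single T]
  · rw [MvPolynomial.coeff_monomial, if_pos rfl]
  · intro T' _ hT'
    rw [MvPolynomial.coeff_monomial, if_neg]
    intro h
    exact hT' (Subtype.ext (word_inj hc hc (mem_powersetCard.1 T'.2).1
      (mem_powersetCard.1 T.2).1 h).2)
  · simp

theorem coords_polyOf_self {m : ℕ} {c : Finset (Fin m) × Finset (Fin m)} (hc : Disjoint c.1 c.2)
    {t : ℕ} (g : powersetCard t (rest c) → ZMod 2) : coords c t (polyOf c t g) = g :=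
  funext fun T => coeff_polyOf_word hc g T

theorem coords_polyOf_of_ne {m : ℕ} {c c' : Finset (Fin m) × Finset (Fin m)}
    (hc : Disjoint c.1 c.2) (hc' : Disjoint c'.1 c'.2) (h : c ≠ c') {t t' : ℕ}
    (g : powersetCard t (rest c) → ZMod 2) : coords c' t' (polyOf c t g) = 0 :=
  funext fun T' => coeff_polyOf_eq_zero g fun _ hT hw =>
    h (word_inj hc' hc (mem_powersetCard.1 T'.2).1 (mem_powersetCard.1 hT).1 hw).1.symm

theorem coeff_Sq_word {m k : ℕ} {c : Finset (Fin m) × Finset (Fin m)} (hc : Disjoint c.1 c.2)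
    {T₀ T : Finset (Fin m)} (hT₀ : T₀ ⊆ rest c) (hT : T ⊆ rest c) :
    MvPolynomial.coeff (word c T) (Sq m k (MvPolynomial.monomial (word c T₀) 1)) =
      if T₀ ⊆ T ∧ #T = #T₀ + k then 1 else 0 := by
  rw [coeff_Sq_monomial_of_le_three _ _ _ _ (word_le_three c T)]
  have h1 := degree_word_add hc hT
  have h2 := degree_word_add hc hT₀
  refine if_congr (and_congr ?_ ?_) rfl rfl
  · rw [word_step_iff hT]
    constructor
    · rintro ⟨T₁, h, he⟩
      rwa [(word_inj hc hc hT₀ (h.trans hT) he).2]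
    · exact fun h => ⟨T₀, h, rfl⟩
  · omega

/-- On the monomials of one class, the square of a monomial of positive degree is either zero or
one of the functions `upVec`. -/
theorem classMap_Sq {m k : ℕ} (hk : 1 ≤ k) {c : Finset (Fin m) × Finset (Fin m)}
    (hc : Disjoint c.1 c.2) (t : ℕ) (f : P m) : classMap c t (Sq m k f) = 0 := by
  suffices h : classMap c t ∘ₗ Sq m k = 0 from LinearMap.congr_fun h f
  refine MvPolynomial.linearMap_ext fun u => LinearMap.ext_ring ?_
  change classMap c t (Sq m k (MvPolynomial.monomial u 1)) = 0
  rw [classMap_apply, Submodule.mkQ_apply, Submodule.Quotient.mk_eq_zero]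
  by_cases h : coords c t (Sq m k (MvPolynomial.monomial u 1)) = 0
  · rw [h]
    exact Submodule.zero_mem _
  · obtain ⟨⟨T, hT⟩, hne⟩ := Function.ne_iff.1 h
    obtain ⟨hT1, hT2⟩ := mem_powersetCard.1 hT
    rw [coords_apply, coeff_Sq_monomial_of_le_three _ _ _ _ (word_le_three c T)] at hne
    obtain ⟨hstep, hdeg⟩ := (ite_ne_right_iff.1 hne).1
    obtain ⟨T₀, hT₀, rfl⟩ := (word_step_iff hT1 _).1 hstep
    have hd1 := degree_word_add hc hT1
    have hd2 := degree_word_add hc (hT₀.trans hT1)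
    have hup : coords c t (Sq m k (MvPolynomial.monomial (word c T₀) 1)) =
        upVec (rest c) t T₀ := by
      ext ⟨T', hT'⟩
      obtain ⟨hT1', hT2'⟩ := mem_powersetCard.1 hT'
      rw [coords_apply, coeff_Sq_word hc (hT₀.trans hT1) hT1']
      exact if_congr (and_iff_left (by omega)) rfl rfl
    rw [hup]
    exact upVec_mem_upSpan (hT₀.trans hT1) (by omega)

theorem classMap_hit {m : ℕ} {c : Finset (Fin m) × Finset (Fin m)} (hc : Disjoint c.1 c.2)
    (t : ℕ) {f : P m} (hf : f ∈ hit m) : classMap c t f = 0 := by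
  have : hit m ≤ LinearMap.ker (classMap c t) := by
    refine iSup₂_le fun k hk => ?_
    rintro _ ⟨g, rfl⟩
    exact classMap_Sq hk hc t g
  exact this hf

theorem mem_span_monomial_iff {m : ℕ} (p : (Fin m →₀ ℕ) → Prop) (f : P m) :
    f ∈ Submodule.span (ZMod 2) {g : P m | ∃ u, g = MvPolynomial.monomial u 1 ∧ p u} ↔
      ∀ v, MvPolynomial.coeff v f ≠ 0 → p v := by
  have h : {g : P m | ∃ u, g = MvPolynomial.monomial u 1 ∧ p u} =
      (fun u => MvPolynomial.monomial u (1 : ZMod 2)) '' {u | p u} := by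
    ext g
    simp only [Set.mem_ofPred_eq, Set.mem_image]
    exact exists_congr fun u => by rw [and_comm, eq_comm]
  rw [h, ← MvPolynomial.restrictSupport_eq_span, MvPolynomial.mem_restrictSupport_iff]
  simp [Set.subset_def]

theorem mem_Ple_iff {m : ℕ} {ω : ParamVec} {f : P m} : f ∈ Ple m ω ↔
    ∀ v, MvPolynomial.coeff v f ≠ 0 → v.degree = ω.deg ∧ toLex (paramOf v) ≤ toLex ω :=
  mem_span_monomial_iff _ f

theorem mem_Plt_iff {m : ℕ} {ω : ParamVec} {f : P m} : f ∈ Plt m ω ↔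
    ∀ v, MvPolynomial.coeff v f ≠ 0 → v.degree = ω.deg ∧ toLex (paramOf v) < toLex ω :=
  mem_span_monomial_iff _ f

theorem mem_Pzero_iff {m : ℕ} {f : P m} : f ∈ Pzero m ↔
    ∀ v, MvPolynomial.coeff v f ≠ 0 → ∏ j, v j = 0 :=
  mem_span_monomial_iff _ f

theorem mem_Ppos_iff {m : ℕ} {f : P m} : f ∈ Ppos m ↔
    ∀ v, MvPolynomial.coeff v f ≠ 0 → 0 < ∏ j, v j :=
  mem_span_monomial_iff _ f

theorem prod_word_eq_zero_iff {m : ℕ} (c : Finset (Fin m) × Finset (Fin m))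
    (T : Finset (Fin m)) : ∏ j, word c T j = 0 ↔ c.1 ≠ ∅ := by
  rw [prod_eq_zero_iff, ← nonempty_iff_ne_empty, ← filter_word_eq_zero c T, filter_nonempty_iff]

section

variable {m a e b : ℕ}

theorem classMap_Plt (hm : a + e = m) {c : Finset (Fin m) × Finset (Fin m)}
    (hc : c ∈ classes m e b) {f : P m} (hf : f ∈ Plt m (pv a b)) :
    classMap c (e - #c.1) f = 0 := by
  have : coords c (e - #c.1) f = 0 := by
    ext T
    by_contra h
    have h2 := (mem_Plt_iff.1 hf _ h).2
    rw [paramOf_word hm hc T.2] at h2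
    exact lt_irrefl _ h2
  rw [classMap_apply, this, map_zero]

theorem polyOf_mem_Ple (hm : a + e = m) {c : Finset (Fin m) × Finset (Fin m)}
    (hc : c ∈ classes m e b) (g : powersetCard (e - #c.1) (rest c) → ZMod 2) :
    polyOf c _ g ∈ Ple m (pv a b) := by
  rw [polyOf_apply]
  refine Submodule.sum_mem _ fun T _ => mem_Ple_iff.2 fun v hv => ?_
  rw [MvPolynomial.coeff_monomial] at hv
  obtain ⟨rfl, -⟩ := ite_ne_right_iff.1 hv
  rw [paramOf_word hm hc T.2, degree_word hm hc T.2, deg_pv]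
  exact ⟨rfl, le_rfl⟩

/-- The converse of `classMap_Sq`: the polynomial with coefficient function `upVec` at `T₀` is,
modulo smaller monomials, the square of the monomial `word c T₀`. -/
theorem polyOf_mem_hit_sup_Plt (hm : a + e = m) (he : e ≤ 2) (hb : b ≤ 2)
    {c : Finset (Fin m) × Finset (Fin m)} (hc : c ∈ classes m e b)
    {g : powersetCard (e - #c.1) (rest c) → ZMod 2} (hg : g ∈ upSpan (rest c) (e - #c.1)) :
    polyOf c _ g ∈ hit m ⊔ Plt m (pv a b) := by
  suffices h : upSpan (rest c) (e - #c.1) ≤ (hit m ⊔ Plt m (pv a b)).comap (polyOf c _) from h hg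
  have hcd := (mem_classes.1 hc).1
  rw [upSpan, Submodule.span_le]
  rintro _ ⟨T₀, hT₀, hlt, rfl⟩
  obtain ⟨k, hk⟩ : ∃ k, e - #c.1 = #T₀ + k := ⟨_, (Nat.add_sub_cancel' hlt.le).symm⟩
  have hk1 : 1 ≤ k := by omega
  set S := Sq m k (MvPolynomial.monomial (word c T₀) 1) with hS
  have hhit : S ∈ hit m :=
    Submodule.mem_iSup_of_mem k (Submodule.mem_iSup_of_mem hk1 ⟨_, rfl⟩)
  change polyOf c (e - #c.1) (upVec (rest c) _ T₀) ∈ hit m ⊔ Plt m (pv a b)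
  rw [← sub_sub_cancel S (polyOf c _ (upVec (rest c) (e - #c.1) T₀))]
  refine Submodule.sub_mem _ (Submodule.mem_sup_left hhit) (Submodule.mem_sup_right ?_)
  rw [mem_Plt_iff]
  intro v hv
  rw [MvPolynomial.coeff_sub] at hv
  -- On the class of `c`, the two polynomials have the same coefficients.
  have hvc : ∀ T ∈ powersetCard (e - #c.1) (rest c), v ≠ word c T := by
    rintro T hT rfl
    obtain ⟨hT1, hT2⟩ := mem_powersetCard.1 hT
    rw [coeff_polyOf_word hcd _ ⟨T, hT⟩, hS, coeff_Sq_word hcd hT₀ hT1] at hv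
    apply hv
    rw [sub_eq_zero]
    exact if_congr (and_iff_left (by omega)) rfl rfl
  rw [coeff_polyOf_eq_zero _ hvc, sub_zero] at hv
  have hdeg := degree_eq_of_coeff_Sq_ne_zero hv
  have hdegv : v.degree = a + 2 * b := by
    have h1 := degree_word_add hcd hT₀
    have h2 := (mem_classes.1 hc).2
    omega
  rw [deg_pv]
  refine ⟨hdegv, ?_⟩
  by_contra hnlt
  rcases le_three_or_one_or_three hm he hb hdegv hnlt with ⟨hp, h3⟩ | h13
  · obtain ⟨c', hc', T', hT', rfl⟩ := eq_word_of_paramOf_eq hm h3 hp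
    have hT1' := (mem_powersetCard.1 hT').1
    rw [hS, coeff_Sq_monomial_of_le_three _ _ _ _ h3] at hv
    obtain ⟨T₁, hT₁, heq⟩ := (word_step_iff hT1' _).1 (ite_ne_right_iff.1 hv).1.1
    obtain rfl := (word_inj hcd (mem_classes.1 hc').1 hT₀ (hT₁.trans hT1') heq).1
    exact hvc T' hT' rfl
  · -- A monomial without exponents `2` is not changed by a square of positive degree.
    rw [hS, coeff_Sq_monomial_of_le_three _ _ _ _ fun j => by rcases h13 j with h | h <;> omega]
      at hv
    obtain ⟨hstep, hd⟩ := (ite_ne_right_iff.1 hv).1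
    have : word c T₀ = v := by
      ext j
      rcases hstep j with h | ⟨-, h⟩
      · exact h
      · rcases h13 j with h' | h' <;> omega
    rw [this] at hd
    omega

theorem mem_hit_sup_Plt_iff (hm : a + e = m) (he : e ≤ 2) (hb : b ≤ 2) {f : P m}
    (hf : f ∈ Ple m (pv a b)) :
    f ∈ hit m ⊔ Plt m (pv a b) ↔ ∀ c ∈ classes m e b, classMap c (e - #c.1) f = 0 := by
  constructor
  · intro h c hc
    obtain ⟨g, hg, l, hl, rfl⟩ := Submodule.mem_sup.1 h
    rw [map_add, classMap_hit (mem_classes.1 hc).1 _ hg, classMap_Plt hm hc hl, add_zero]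
  · intro h
    rw [← sub_add_cancel f (∑ c ∈ classes m e b, polyOf c _ (coords c (e - #c.1) f))]
    refine Submodule.add_mem _ (Submodule.mem_sup_right ?_) (Submodule.sum_mem _ fun c hc => ?_)
    · rw [mem_Plt_iff]
      intro v hv
      have hsum : ∑ c ∈ classes m e b, polyOf c _ (coords c (e - #c.1) f) ∈ Ple m (pv a b) :=
        Submodule.sum_mem _ fun c hc => polyOf_mem_Ple hm hc _
      obtain ⟨hdeg, hle⟩ := mem_Ple_iff.1 (Submodule.sub_mem _ hf hsum) v hv
      refine ⟨hdeg, lt_of_le_of_ne hle fun heq => hv ?_⟩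
      have hp : paramOf v = pv a b := heq
      rw [deg_pv] at hdeg
      have h3 : ∀ j, v j ≤ 3 := by
        rcases le_three_or_one_or_three hm he hb hdeg (by rw [hp]; exact lt_irrefl _) with h | h
        · exact h.2
        · exact fun j => by rcases h j with h | h <;> omega
      obtain ⟨c, hc, T, hT, rfl⟩ := eq_word_of_paramOf_eq hm h3 hp
      rw [MvPolynomial.coeff_sub, MvPolynomial.coeff_sum, sum_eq_single c,
        coeff_polyOf_word (mem_classes.1 hc).1 _ ⟨T, hT⟩, coords_apply, sub_self]
      · intro c' hc' hne
        exact coeff_polyOf_eq_zero _ fun T' hT' hw => hne (word_inj (mem_classes.1 hc).1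
          (mem_classes.1 hc').1 (mem_powersetCard.1 hT).1 (mem_powersetCard.1 hT').1 hw).1.symm
      · exact fun h => absurd hc h
    · refine polyOf_mem_hit_sup_Plt hm he hb hc ?_
      rw [← Submodule.Quotient.mk_eq_zero]
      exact h c hc

/-- Any prescribed classes on a set `S` of classes are realized by a polynomial that involves only
monomials of these classes. -/
theorem exists_classMap_eq (hm : a + e = m) {S : Finset (Finset (Fin m) × Finset (Fin m))}
    (hS : S ⊆ classes m e b) (y : ∀ c : S, Cohit (rest c.1) (e - #c.1.1)) :
    ∃ f ∈ Ple m (pv a b),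
      (∀ v, MvPolynomial.coeff v f ≠ 0 → ∃ c ∈ S, ∃ T, v = word c T) ∧
      (∀ c : S, classMap c.1 (e - #c.1.1) f = y c) ∧
      ∀ c ∈ classes m e b, c ∉ S → classMap c (e - #c.1) f = 0 := by
  choose g hg using fun c : S => Submodule.mkQ_surjective _ (y c)
  have hd : ∀ {c}, c ∈ S → Disjoint c.1 c.2 := fun h => (mem_classes.1 (hS h)).1
  refine ⟨∑ c : S, polyOf c.1 _ (g c),
    Submodule.sum_mem _ fun c _ => polyOf_mem_Ple hm (hS c.2) _, ?_, ?_, ?_⟩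
  · intro v hv
    rw [MvPolynomial.coeff_sum] at hv
    obtain ⟨c, -, hc⟩ := exists_ne_zero_of_sum_ne_zero hv
    refine ⟨c, c.2, ?_⟩
    by_contra! hT
    exact hc (coeff_polyOf_eq_zero _ fun T _ => hT T)
  · intro c
    rw [map_sum, sum_eq_single c]
    · rw [classMap_apply, coords_polyOf_self (hd c.2), hg]
    · intro c' _ hne
      rw [classMap_apply, coords_polyOf_of_ne (hd c'.2) (hd c.2)
        (fun h => hne (Subtype.ext h)), map_zero]
    · simp
  · intro c hc hcS
    rw [map_sum]
    refine sum_eq_zero fun c' _ => ?_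
    rw [classMap_apply, coords_polyOf_of_ne (hd c'.2) (mem_classes.1 hc).1
      (fun h => hcS (h ▸ c'.2)), map_zero]

end

/-! ### The parts with and without vanishing exponents -/

/-- The pairs `(Z, H)` of `classes m e b` with `Z` non-empty. -/
def zeroClasses (m e b : ℕ) : Finset (Finset (Fin m) × Finset (Fin m)) :=
  (classes m e b).filter fun c => c.1 ≠ ∅

/-- The pairs `(Z, H)` of `classes m e b` with `Z` empty. -/
def posClasses (m e b : ℕ) : Finset (Finset (Fin m) × Finset (Fin m)) :=
  (classes m e b).filter fun c => c.1 = ∅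

/-- The product of the spaces `Cohit` over a set of classes. -/
abbrev CohitProd {m : ℕ} (e : ℕ) (S : Finset (Finset (Fin m) × Finset (Fin m))) : Type :=
  ∀ c : S, Cohit (rest c.1) (e - #c.1.1)

/-- The maps `classMap` of a set of classes. -/
noncomputable def cohitProdMap {m : ℕ} (e : ℕ) (S : Finset (Finset (Fin m) × Finset (Fin m))) :
    P m →ₗ[ZMod 2] CohitProd e S :=
  LinearMap.pi fun c : S => classMap c.1 (e - #c.1.1)

/-- All maps `classMap`, grouped into the classes with and without vanishing exponents. -/
noncomputable def totalMap (m e b : ℕ) :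
    P m →ₗ[ZMod 2] CohitProd e (zeroClasses m e b) × CohitProd e (posClasses m e b) :=
  (cohitProdMap e (zeroClasses m e b)).prod (cohitProdMap e (posClasses m e b))

section

variable {m a e b : ℕ}

theorem totalMap_eq_zero_iff {f : P m} :
    totalMap m e b f = 0 ↔ ∀ c ∈ classes m e b, classMap c (e - #c.1) f = 0 := by
  rw [Prod.ext_iff, funext_iff, funext_iff]
  constructor
  · rintro ⟨h0, h1⟩ c hc
    by_cases h : c.1 = ∅
    · exact h1 ⟨c, mem_filter.2 ⟨hc, h⟩⟩
    · exact h0 ⟨c, mem_filter.2 ⟨hc, h⟩⟩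
  · exact fun h => ⟨fun c => h c.1 (mem_filter.1 c.2).1, fun c => h c.1 (mem_filter.1 c.2).1⟩

theorem ker_totalMap (hm : a + e = m) (he : e ≤ 2) (hb : b ≤ 2) :
    LinearMap.ker (totalMap m e b ∘ₗ (Ple m (pv a b)).subtype) = null m (pv a b) := by
  ext f
  rw [LinearMap.mem_ker, LinearMap.comp_apply, totalMap_eq_zero_iff]
  exact (mem_hit_sup_Plt_iff hm he hb f.2).symm

theorem exists_totalMap_eq_inl (hm : a + e = m) (y : CohitProd e (zeroClasses m e b)) :
    ∃ f ∈ Ple m (pv a b), f ∈ Pzero m ∧ totalMap m e b f = (y, 0) := by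
  obtain ⟨f, hf, h1, h2, h3⟩ := exists_classMap_eq hm (filter_subset _ _) y
  refine ⟨f, hf, mem_Pzero_iff.2 fun v hv => ?_, Prod.ext (funext h2) (funext fun c => ?_)⟩
  · obtain ⟨c, hc, T, rfl⟩ := h1 v hv
    exact (prod_word_eq_zero_iff c T).2 (mem_filter.1 hc).2
  · obtain ⟨hc, hc'⟩ := mem_filter.1 c.2
    exact h3 c.1 hc fun h => (mem_filter.1 h).2 hc'

theorem exists_totalMap_eq_inr (hm : a + e = m) (y : CohitProd e (posClasses m e b)) :
    ∃ f ∈ Ple m (pv a b), f ∈ Ppos m ∧ totalMap m e b f = (0, y) := by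
  obtain ⟨f, hf, h1, h2, h3⟩ := exists_classMap_eq hm (filter_subset _ _) y
  refine ⟨f, hf, mem_Ppos_iff.2 fun v hv => ?_, Prod.ext (funext fun c => ?_) (funext h2)⟩
  · obtain ⟨c, hc, T, rfl⟩ := h1 v hv
    refine Nat.pos_of_ne_zero fun h => ?_
    exact (prod_word_eq_zero_iff c T).1 h (mem_filter.1 hc).2
  · obtain ⟨hc, hc'⟩ := mem_filter.1 c.2
    exact h3 c.1 hc fun h => hc' (mem_filter.1 h).2

theorem totalMap_snd_of_mem_Pzero {f : P m} (hf : f ∈ Pzero m) : (totalMap m e b f).2 = 0 := by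
  ext1 c
  obtain ⟨-, hc⟩ := mem_filter.1 c.2
  have : coords c.1 (e - #c.1.1) f = 0 := by
    ext T
    by_contra h
    exact (prod_word_eq_zero_iff c.1 T.1).1 (mem_Pzero_iff.1 hf _ h) hc
  change classMap c.1 _ f = 0
  rw [classMap_apply, this, map_zero]

theorem totalMap_fst_of_mem_Ppos {f : P m} (hf : f ∈ Ppos m) : (totalMap m e b f).1 = 0 := by
  ext1 c
  obtain ⟨-, hc⟩ := mem_filter.1 c.2
  have : coords c.1 (e - #c.1.1) f = 0 := by
    ext T
    by_contra h
    exact (mem_Ppos_iff.1 hf _ h).ne' ((prod_word_eq_zero_iff c.1 T.1).2 hc)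
  change classMap c.1 _ f = 0
  rw [classMap_apply, this, map_zero]

/-- The isomorphism induced by `totalMap` takes the two subspaces `Qzero` and `Qpos` to the two
factors of the product. -/
theorem exists_equiv_cohitProd (hm : a + e = m) (he : e ≤ 2) (hb : b ≤ 2) :
    ∃ E : Q m (pv a b) ≃ₗ[ZMod 2]
        CohitProd e (zeroClasses m e b) × CohitProd e (posClasses m e b),
      (Qzero m (pv a b)).map E.toLinearMap =
        LinearMap.range (LinearMap.inl (ZMod 2) (CohitProd e (zeroClasses m e b))
          (CohitProd e (posClasses m e b))) ∧
      (Qpos m (pv a b)).map E.toLinearMap =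
        LinearMap.range (LinearMap.inr (ZMod 2) (CohitProd e (zeroClasses m e b))
          (CohitProd e (posClasses m e b))) := by
  set φ := totalMap m e b ∘ₗ (Ple m (pv a b)).subtype with hφ
  have hsurj : Function.Surjective φ := by
    rintro ⟨y, z⟩
    obtain ⟨f, hf, -, hy⟩ := exists_totalMap_eq_inl hm y
    obtain ⟨g, hg, -, hz⟩ := exists_totalMap_eq_inr hm z
    refine ⟨⟨f, hf⟩ + ⟨g, hg⟩, ?_⟩
    rw [map_add]
    change totalMap m e b f + totalMap m e b g = _
    rw [hy, hz, Prod.mk_add_mk, add_zero, zero_add]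
  let E := (Submodule.quotEquivOfEq _ _ (ker_totalMap hm he hb).symm).trans
    (φ.quotKerEquivOfSurjective hsurj)
  have hE : E.toLinearMap ∘ₗ (null m (pv a b)).mkQ = φ := by
    ext f : 1
    rfl
  refine ⟨E, ?_, ?_⟩
  · rw [Qzero, ← Submodule.map_comp, hE]
    apply le_antisymm
    · rintro _ ⟨f, hf, rfl⟩
      exact ⟨(totalMap m e b f.1).1, Prod.ext rfl (totalMap_snd_of_mem_Pzero hf).symm⟩
    · rintro _ ⟨y, rfl⟩
      obtain ⟨f, hf, hf0, hy⟩ := exists_totalMap_eq_inl hm y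
      exact ⟨⟨f, hf⟩, hf0, hy⟩
  · rw [Qpos, ← Submodule.map_comp, hE]
    apply le_antisymm
    · rintro _ ⟨f, hf, rfl⟩
      exact ⟨(totalMap m e b f.1).2, Prod.ext (totalMap_fst_of_mem_Ppos hf).symm rfl⟩
    · rintro _ ⟨y, rfl⟩
      obtain ⟨f, hf, hf0, hy⟩ := exists_totalMap_eq_inr hm y
      exact ⟨⟨f, hf⟩, hf0, hy⟩

theorem isCompl_Qzero_Qpos (hm : a + e = m) (he : e ≤ 2) (hb : b ≤ 2) :
    IsCompl (Qzero m (pv a b)) (Qpos m (pv a b)) := by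
  obtain ⟨E, h0, h1⟩ := exists_equiv_cohitProd hm he hb
  rw [(Submodule.orderIsoMapComap E).isCompl_iff]
  change IsCompl ((Qzero m (pv a b)).map E.toLinearMap) ((Qpos m (pv a b)).map E.toLinearMap)
  rw [h0, h1]
  exact LinearMap.isCompl_range_inl_inr

theorem dimQzero_eq_sum (hm : a + e = m) (he : e ≤ 2) (hb : b ≤ 2) :
    dimQzero m (pv a b) = ∑ c ∈ zeroClasses m e b,
      Module.finrank (ZMod 2) (Cohit (rest c) (e - #c.1)) := by
  obtain ⟨E, h0, h1⟩ := exists_equiv_cohitProd hm he hb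
  rw [dimQzero, ← LinearEquiv.finrank_map_eq E]
  change Module.finrank (ZMod 2) ((Qzero m (pv a b)).map E.toLinearMap) = _
  rw [h0, LinearMap.finrank_range_of_inj LinearMap.inl_injective, Module.finrank_pi_fintype,
    sum_coe_sort _ fun c : Finset (Fin m) × Finset (Fin m) =>
      Module.finrank (ZMod 2) (Cohit (rest c) (e - #c.1))]

theorem dimQpos_eq_sum (hm : a + e = m) (he : e ≤ 2) (hb : b ≤ 2) :
    dimQpos m (pv a b) = ∑ c ∈ posClasses m e b,
      Module.finrank (ZMod 2) (Cohit (rest c) (e - #c.1)) := by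
  obtain ⟨E, h0, h1⟩ := exists_equiv_cohitProd hm he hb
  rw [dimQpos, ← LinearEquiv.finrank_map_eq E]
  change Module.finrank (ZMod 2) ((Qpos m (pv a b)).map E.toLinearMap) = _
  rw [h1, LinearMap.finrank_range_of_inj LinearMap.inr_injective, Module.finrank_pi_fintype,
    sum_coe_sort _ fun c : Finset (Fin m) × Finset (Fin m) =>
      Module.finrank (ZMod 2) (Cohit (rest c) (e - #c.1))]

theorem dimQ_eq_add (hm : a + e = m) (he : e ≤ 2) (hb : b ≤ 2) :
    dimQ m (pv a b) = dimQzero m (pv a b) + dimQpos m (pv a b) :=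
  (Submodule.finrank_add_eq_of_isCompl (isCompl_Qzero_Qpos hm he hb)).symm

end

/-! ### Counting the classes -/

/-- The pairs of disjoint sets of variables of sizes `z` and `h`. -/
def disjointPairs (m z h : ℕ) : Finset (Finset (Fin m) × Finset (Fin m)) :=
  univ.filter fun c => Disjoint c.1 c.2 ∧ #c.1 = z ∧ #c.2 = h

theorem mem_disjointPairs {m z h : ℕ} {c : Finset (Fin m) × Finset (Fin m)} :
    c ∈ disjointPairs m z h ↔ Disjoint c.1 c.2 ∧ #c.1 = z ∧ #c.2 = h := by
  simp [disjointPairs]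

theorem card_disjointPairs (m z h : ℕ) :
    #(disjointPairs m z h) = m.choose z * (m - z).choose h := by
  have hs : disjointPairs m z h =
      ((powersetCard z univ).sigma fun Z => powersetCard h Zᶜ).map
        (Equiv.sigmaEquivProd (Finset (Fin m)) (Finset (Fin m))).toEmbedding := by
    ext ⟨Z, H⟩
    simp only [mem_disjointPairs, mem_map_equiv, mem_sigma, Equiv.sigmaEquivProd_symm_apply,
      mem_powersetCard, subset_univ, true_and, subset_compl_comm (s := H),
      subset_compl_iff_disjoint_right]
    tauto
  rw [hs, card_map, card_sigma, sum_congr rfl (g := fun _ => (m - z).choose h), sum_const,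
    card_powersetCard, card_univ, Fintype.card_fin, smul_eq_mul]
  intro Z hZ
  rw [card_powersetCard, card_compl, Fintype.card_fin, (mem_powersetCard.1 hZ).2]

theorem card_rest {m z h : ℕ} {c : Finset (Fin m) × Finset (Fin m)}
    (hc : c ∈ disjointPairs m z h) : #(rest c) = m - (z + h) := by
  obtain ⟨h1, h2, h3⟩ := mem_disjointPairs.1 hc
  rw [rest, card_compl, Fintype.card_fin, card_union_of_disjoint h1, h2, h3]

theorem sum_disjointPairs {m z h : ℕ} {F : Finset (Fin m) × Finset (Fin m) → ℕ} {d : ℕ}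
    (hF : ∀ c ∈ disjointPairs m z h, F c = d) :
    ∑ c ∈ disjointPairs m z h, F c = m.choose z * (m - z).choose h * d := by
  rw [sum_congr rfl hF, sum_const, card_disjointPairs, smul_eq_mul]

theorem posClasses_eq (m e h : ℕ) : posClasses m e (h + e) = disjointPairs m 0 h := by
  ext c
  simp only [posClasses, mem_filter, mem_classes, mem_disjointPairs, card_eq_zero]
  constructor
  · rintro ⟨⟨h1, h2, h3⟩, h4⟩
    rw [h4, card_empty] at h3
    exact ⟨h1, h4, by omega⟩
  · rintro ⟨h1, h2, h3⟩
    rw [h2, card_empty]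
    exact ⟨⟨h2 ▸ h1, by omega, by omega⟩, rfl⟩

theorem zeroClasses_zero (m b : ℕ) : zeroClasses m 0 b = ∅ := by
  ext c
  simp only [zeroClasses, mem_filter, mem_classes, ne_eq, ← card_eq_zero, notMem_empty, iff_false]
  omega

theorem zeroClasses_one (m b : ℕ) : zeroClasses m 1 b = disjointPairs m 1 b := by
  ext c
  simp only [zeroClasses, mem_filter, mem_classes, mem_disjointPairs, ne_eq, ← card_eq_zero]
  constructor
  · rintro ⟨⟨h1, h2, h3⟩, h4⟩
    exact ⟨h1, by omega, by omega⟩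
  · rintro ⟨h1, h2, h3⟩
    exact ⟨⟨h1, by omega, by omega⟩, by omega⟩

theorem zeroClasses_two (m b : ℕ) :
    zeroClasses m 2 (b + 1) = disjointPairs m 1 b ∪ disjointPairs m 2 (b + 1) := by
  ext c
  simp only [zeroClasses, mem_filter, mem_classes, mem_disjointPairs, mem_union, ne_eq,
    ← card_eq_zero]
  constructor
  · rintro ⟨⟨h1, h2, h3⟩, h4⟩
    obtain h | h : #c.1 = 1 ∨ #c.1 = 2 := by omega
    · exact Or.inl ⟨h1, h, by omega⟩
    · exact Or.inr ⟨h1, h, by omega⟩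
  · rintro (⟨h1, h2, h3⟩ | ⟨h1, h2, h3⟩)
    · exact ⟨⟨h1, by omega, by omega⟩, by omega⟩
    · exact ⟨⟨h1, by omega, by omega⟩, by omega⟩

/-! ### The dimensions -/

theorem dims_zero {m b : ℕ} (hb : b ≤ 2) :
    dimQzero m (pv m b) = 0 ∧ dimQpos m (pv m b) = m.choose b := by
  constructor
  · rw [dimQzero_eq_sum (add_zero m) (by norm_num) hb, zeroClasses_zero, sum_empty]
  · rw [dimQpos_eq_sum (add_zero m) (by norm_num) hb]
    have := posClasses_eq m 0 b
    rw [add_zero] at this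
    rw [this, sum_disjointPairs (d := 1)]
    · simp
    · intro c hc
      rw [Nat.zero_sub, finrank_cohit_zero]

theorem dims_one {m b : ℕ} (hm : 1 ≤ m) (hb : b ≤ 1) :
    dimQzero m (pv (m - 1) (b + 1)) = m * (m - 1).choose (b + 1) ∧
      dimQpos m (pv (m - 1) (b + 1)) = m.choose b * (m - b - 1) := by
  have hme : m - 1 + 1 = m := Nat.sub_add_cancel hm
  constructor
  · rw [dimQzero_eq_sum hme (by norm_num) (by omega), zeroClasses_one, sum_disjointPairs (d := 1)]
    · simp
    · intro c hc
      rw [(mem_disjointPairs.1 hc).2.1, finrank_cohit_zero]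
  · rw [dimQpos_eq_sum hme (by norm_num) (by omega), posClasses_eq,
      sum_disjointPairs (d := m - b - 1)]
    · simp
    · intro c hc
      rw [(mem_disjointPairs.1 hc).2.1, finrank_cohit_one, card_rest hc, zero_add]

theorem dims_two {m : ℕ} (hm : 2 ≤ m) :
    dimQzero m (pv (m - 2) 2) =
        m * (m - 1) * (m - 3) + m.choose 2 * (m - 2).choose 2 ∧
      dimQpos m (pv (m - 2) 2) = (m - 1).choose 2 - 1 := by
  have hme : m - 2 + 2 = m := Nat.sub_add_cancel hm
  constructor
  · rw [dimQzero_eq_sum hme le_rfl le_rfl, zeroClasses_two m 1, sum_union,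
      sum_disjointPairs (d := m - 3), sum_disjointPairs (d := 1)]
    · simp
    · intro c hc
      rw [(mem_disjointPairs.1 hc).2.1, finrank_cohit_zero]
    · intro c hc
      rw [(mem_disjointPairs.1 hc).2.1, finrank_cohit_one, card_rest hc]
      omega
    · rw [disjoint_left]
      intro c h1 h2
      have h1 := (mem_disjointPairs.1 h1).2.1
      have h2 := (mem_disjointPairs.1 h2).2.1
      omega
  · have := posClasses_eq m 2 0
    rw [zero_add] at this
    rw [dimQpos_eq_sum hme le_rfl le_rfl, this, sum_disjointPairs (d := (m - 1).choose 2 - 1)]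
    · simp
    · intro c hc
      rw [(mem_disjointPairs.1 hc).2.1, finrank_cohit_two, card_rest hc]
      rfl

theorem mul_choose_two (m : ℕ) : m * (m - 1).choose 2 = 3 * m.choose 3 := by
  rcases m with _ | m
  · simp
  · rw [Nat.add_sub_cancel, Nat.add_one_mul_choose_eq, mul_comm]

theorem dimQzero_two_identity {m : ℕ} (hm : 2 ≤ m) :
    m * (m - 1) * (m - 3) + m.choose 2 * (m - 2).choose 2 =
      (m.choose 2 + m - 1) * ((m - 1).choose 2 - 1) := by
  obtain rfl | ⟨n, rfl⟩ : m = 2 ∨ ∃ n, m = n + 3 := by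
    rcases hm.eq_or_lt with h | h
    · exact Or.inl h.symm
    · exact Or.inr ⟨m - 3, by omega⟩
  · decide
  · have h1 : 1 ≤ (n + 3 - 1).choose 2 := Nat.choose_pos (by omega)
    have h2 : 1 ≤ (n + 3).choose 2 + (n + 3) := by omega
    have e1 : n + 3 - 1 = n + 2 := rfl
    have e2 : n + 3 - 2 = n + 1 := rfl
    have e3 : n + 3 - 3 = n := rfl
    rw [e1, e2, e3]
    rw [e1] at h1
    rw [← Nat.cast_inj (R := ℚ)]
    push_cast [Nat.cast_sub h1, Nat.cast_sub h2, Nat.cast_choose_two]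
    ring

theorem pow_four_le_prod {m : ℕ} (hm : 4 ≤ m) : m ^ 4 ≤ ∏ j ∈ Icc 1 m, (2 ^ j - 1) := by
  induction m, hm using Nat.le_induction with
  | base => decide
  | succ m hm ih =>
    rw [prod_Icc_succ_top (by omega)]
    have h1 : 3 ≤ 2 ^ (m + 1) - 1 := by
      have : 2 ^ 2 ≤ 2 ^ (m + 1) := Nat.pow_le_pow_right (by norm_num) (by omega)
      omega
    have h2 : (m + 1) ^ 4 ≤ m ^ 4 * 3 := by
      obtain ⟨n, rfl⟩ := Nat.exists_eq_add_of_le hm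
      ring_nf
      nlinarith [sq_nonneg n]
    exact h2.trans (Nat.mul_le_mul ih h1)

/-- The right-hand side of the localized Kameko inequality is at least `m ^ 4` from `m = 4` on. -/
theorem le_prod_of_le_pow_four {m d : ℕ} (h : 4 ≤ m → d ≤ m ^ 4)
    (h' : m ≤ 3 → d ≤ ∏ j ∈ Icc 1 m, (2 ^ j - 1)) : d ≤ ∏ j ∈ Icc 1 m, (2 ^ j - 1) := by
  by_cases hm : 4 ≤ m
  · exact (h hm).trans (pow_four_le_prod hm)
  · exact h' (by omega)

theorem dimQ_zero_zero (m : ℕ) : dimQ m (pv m 0) = 1 := by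
  obtain ⟨h1, h2⟩ := dims_zero (m := m) (b := 0) (by norm_num)
  rw [dimQ_eq_add (add_zero m) (by norm_num) (by norm_num), h1, h2, Nat.choose_zero_right]

theorem dimQ_zero_one (m : ℕ) : dimQ m (pv m 1) = m := by
  obtain ⟨h1, h2⟩ := dims_zero (m := m) (b := 1) (by norm_num)
  rw [dimQ_eq_add (add_zero m) (by norm_num) (by norm_num), h1, h2, Nat.choose_one_right, zero_add]

theorem dimQ_one_one {m : ℕ} (hm : 1 ≤ m) : dimQ m (pv (m - 1) 1) = m ^ 2 - 1 := by
  obtain ⟨h1, h2⟩ := dims_one (b := 0) hm (by norm_num)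
  rw [zero_add] at h1 h2
  rw [dimQ_eq_add (Nat.sub_add_cancel hm) (by norm_num) (by norm_num), h1, h2]
  obtain ⟨n, rfl⟩ := Nat.exists_eq_add_of_le' hm
  rw [Nat.choose_one_right, Nat.choose_zero_right, Nat.sub_zero, Nat.add_sub_cancel]
  exact (Nat.sub_eq_of_eq_add (by ring)).symm

theorem dimQ_one_two {m : ℕ} (hm : 1 ≤ m) :
    dimQ m (pv (m - 1) 2) = 3 * m.choose 3 + m * (m - 2) := by
  obtain ⟨h1, h2⟩ := dims_one (b := 1) hm le_rfl
  rw [dimQ_eq_add (Nat.sub_add_cancel hm) (by norm_num) le_rfl, h1, h2, mul_choose_two,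
    Nat.choose_one_right]
  rfl

theorem dimQ_two_two {m : ℕ} (hm : 2 ≤ m) :
    dimQ m (pv (m - 2) 2) = (m.choose 2 + m) * ((m - 1).choose 2 - 1) := by
  obtain ⟨h1, h2⟩ := dims_two hm
  rw [dimQ_eq_add (Nat.sub_add_cancel hm) le_rfl le_rfl, h1, h2, dimQzero_two_identity hm]
  obtain ⟨k, hk⟩ : ∃ k, m.choose 2 + m = k + 1 := ⟨m.choose 2 + m - 1, by omega⟩
  rw [hk, Nat.add_sub_cancel]
  ring

theorem localizedKameko_zero_zero {m : ℕ} (hm : 1 ≤ m) : LocalizedKameko m (pv m 0) := by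
  rw [LocalizedKameko, dimQ_zero_zero]
  refine le_prod_of_le_pow_four (fun _ => Nat.one_le_pow _ _ hm) fun h => ?_
  interval_cases m <;> decide

theorem localizedKameko_zero_one {m : ℕ} (hm : 1 ≤ m) : LocalizedKameko m (pv m 1) := by
  rw [LocalizedKameko, dimQ_zero_one]
  refine le_prod_of_le_pow_four (fun _ => Nat.le_self_pow (by norm_num) m) fun h => ?_
  interval_cases m <;> decide

theorem localizedKameko_one_one {m : ℕ} (hm : 1 ≤ m) : LocalizedKameko m (pv (m - 1) 1) := by
  rw [LocalizedKameko, dimQ_one_one hm]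
  refine le_prod_of_le_pow_four (fun _ => ?_) fun h => ?_
  · exact (Nat.sub_le _ _).trans (Nat.pow_le_pow_right hm (by norm_num))
  · interval_cases m <;> decide

theorem localizedKameko_one_two {m : ℕ} (hm : 1 ≤ m) : LocalizedKameko m (pv (m - 1) 2) := by
  rw [LocalizedKameko, dimQ_one_two hm]
  refine le_prod_of_le_pow_four (fun h4 => ?_) fun h => ?_
  · calc 3 * m.choose 3 + m * (m - 2) ≤ 3 * m ^ 3 + m * m := by
          gcongr
          · exact Nat.choose_le_pow m 3
          · exact Nat.sub_le _ _
      _ ≤ m ^ 4 := by nlinarith [Nat.pow_le_pow_left h4 2, Nat.mul_le_mul_right (m ^ 3) h4]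
  · interval_cases m <;> decide

theorem localizedKameko_two_two {m : ℕ} (hm : 2 ≤ m) : LocalizedKameko m (pv (m - 2) 2) := by
  rw [LocalizedKameko, dimQ_two_two hm]
  refine le_prod_of_le_pow_four (fun h4 => ?_) fun h => ?_
  · have h1 : m.choose 2 + m ≤ m ^ 2 := by
      have : (m + 1).choose 2 = m.choose 2 + m := by
        rw [Nat.choose_succ_succ' m 1, Nat.choose_one_right, add_comm]
      rw [← this, Nat.choose_two_right, Nat.add_sub_cancel]
      refine Nat.div_le_of_le_mul ?_
      nlinarith
    have h2 : (m - 1).choose 2 - 1 ≤ m ^ 2 :=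
      (Nat.sub_le _ _).trans
        ((Nat.choose_le_pow _ _).trans (Nat.pow_le_pow_left (Nat.sub_le _ _) 2))
    calc _ ≤ m ^ 2 * m ^ 2 := Nat.mul_le_mul h1 h2
      _ = m ^ 4 := by ring
  · interval_cases m <;> decide

end Hit

theorem mainTheorem8 :
    -- the parameter vector `(m, 0)`, of degree `m`
    (∀ m : ℕ, 0 < m →
      (Hit.pv m 0).deg = m ∧
      Hit.dimQ m (Hit.pv m 0) = 1 ∧
      Hit.dimQzero m (Hit.pv m 0) = 0 ∧
      Hit.dimQpos m (Hit.pv m 0) = 1 ∧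
      IsCompl (Hit.Qzero m (Hit.pv m 0)) (Hit.Qpos m (Hit.pv m 0))) ∧
    -- the parameter vector `(m - 1, 1)`, of degree `m + 1`
    (∀ m : ℕ, 1 < m →
      (Hit.pv (m - 1) 1).deg = m + 1 ∧
      Hit.dimQ m (Hit.pv (m - 1) 1) = m ^ 2 - 1 ∧
      Hit.dimQzero m (Hit.pv (m - 1) 1) = m * (m - 1) ∧
      Hit.dimQpos m (Hit.pv (m - 1) 1) = m - 1 ∧
      IsCompl (Hit.Qzero m (Hit.pv (m - 1) 1)) (Hit.Qpos m (Hit.pv (m - 1) 1))) ∧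
    -- the parameter vector `(m - 2, 2)`, of degree `m + 2`
    (∀ m : ℕ, 3 < m →
      (Hit.pv (m - 2) 2).deg = m + 2 ∧
      Hit.dimQ m (Hit.pv (m - 2) 2) = (m.choose 2 + m) * ((m - 1).choose 2 - 1) ∧
      Hit.dimQzero m (Hit.pv (m - 2) 2) = (m.choose 2 + m - 1) * ((m - 1).choose 2 - 1) ∧
      Hit.dimQpos m (Hit.pv (m - 2) 2) = (m - 1).choose 2 - 1 ∧
      IsCompl (Hit.Qzero m (Hit.pv (m - 2) 2)) (Hit.Qpos m (Hit.pv (m - 2) 2))) ∧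
    -- the parameter vector `(m, 1)`, of degree `m + 2`
    (∀ m : ℕ, 3 < m →
      (Hit.pv m 1).deg = m + 2 ∧
      Hit.dimQ m (Hit.pv m 1) = m ∧
      Hit.dimQzero m (Hit.pv m 1) = 0 ∧
      Hit.dimQpos m (Hit.pv m 1) = m ∧
      IsCompl (Hit.Qzero m (Hit.pv m 1)) (Hit.Qpos m (Hit.pv m 1))) ∧
    -- the parameter vector `(m - 1, 2)`, of degree `m + 3`
    (∀ m : ℕ, 3 < m →
      (Hit.pv (m - 1) 2).deg = m + 3 ∧
      Hit.dimQ m (Hit.pv (m - 1) 2) = 3 * m.choose (m - 3) + m * (m - 2) ∧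
      Hit.dimQzero m (Hit.pv (m - 1) 2) = 3 * m.choose (m - 3) ∧
      Hit.dimQpos m (Hit.pv (m - 1) 2) = m * (m - 2) ∧
      IsCompl (Hit.Qzero m (Hit.pv (m - 1) 2)) (Hit.Qpos m (Hit.pv (m - 1) 2))) ∧
    -- the localized Kameko conjecture for these parameter vectors
    (∀ m : ℕ, 1 ≤ m →
      Hit.LocalizedKameko m (Hit.pv m 0) ∧
      Hit.LocalizedKameko m (Hit.pv (m - 1) 1) ∧
      (2 ≤ m → Hit.LocalizedKameko m (Hit.pv (m - 2) 2)) ∧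
      Hit.LocalizedKameko m (Hit.pv m 1) ∧
      Hit.LocalizedKameko m (Hit.pv (m - 1) 2)) := by
  refine ⟨fun m _ => ?_, fun m hm => ?_, fun m hm => ?_, fun m _ => ?_, fun m hm => ?_,
    fun m hm => ⟨Hit.localizedKameko_zero_zero hm, Hit.localizedKameko_one_one hm,
      Hit.localizedKameko_two_two, Hit.localizedKameko_zero_one hm,
      Hit.localizedKameko_one_two hm⟩⟩
  · obtain ⟨h0, h1⟩ := Hit.dims_zero (m := m) (b := 0) (by norm_num)
    rw [Nat.choose_zero_right] at h1
    exact ⟨by rw [Hit.deg_pv]; rfl, Hit.dimQ_zero_zero m, h0, h1,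
      Hit.isCompl_Qzero_Qpos (add_zero m) (by norm_num) (by norm_num)⟩
  · obtain ⟨h0, h1⟩ := Hit.dims_one (b := 0) hm.le (by norm_num)
    rw [zero_add, Nat.choose_one_right] at h0
    rw [zero_add, Nat.choose_zero_right, one_mul, Nat.sub_zero] at h1
    exact ⟨by rw [Hit.deg_pv]; omega, Hit.dimQ_one_one hm.le, h0, h1,
      Hit.isCompl_Qzero_Qpos (Nat.sub_add_cancel hm.le) (by norm_num) (by norm_num)⟩
  · have h2 : 2 ≤ m := by omega
    obtain ⟨h0, h1⟩ := Hit.dims_two h2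
    rw [Hit.dimQzero_two_identity h2] at h0
    exact ⟨by rw [Hit.deg_pv]; omega, Hit.dimQ_two_two h2, h0, h1,
      Hit.isCompl_Qzero_Qpos (Nat.sub_add_cancel h2) le_rfl le_rfl⟩
  · obtain ⟨h0, h1⟩ := Hit.dims_zero (m := m) (b := 1) (by norm_num)
    rw [Nat.choose_one_right] at h1
    exact ⟨by rw [Hit.deg_pv], Hit.dimQ_zero_one m, h0, h1,
      Hit.isCompl_Qzero_Qpos (add_zero m) (by norm_num) (by norm_num)⟩
  · have hm1 : 1 ≤ m := by omega
    obtain ⟨h0, h1⟩ := Hit.dims_one (b := 1) hm1 le_rfl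
    rw [Hit.mul_choose_two] at h0
    rw [Nat.choose_one_right] at h1
    have h3 : m.choose (m - 3) = m.choose 3 := Nat.choose_symm (by omega)
    rw [h3]
    exact ⟨by rw [Hit.deg_pv]; omega, Hit.dimQ_one_two hm1, h0, h1,
      Hit.isCompl_Qzero_Qpos (Nat.sub_add_cancel hm1) (by norm_num) le_rfl⟩
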